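/- Let $H$ be a complex Hilbert space, $\mathcal B(H)$ the bounded operators with the operator norm $\|\cdot\|$, $\mathcal T(H)$ the trace class operators with the trace norm $\|T\|_1=\mathrm{tr}|T|$, and $\mathcal K(H)$ (respectively $\mathcal K_{\mathrm{sa}}(H)$) the compact (respectively self-adjoint compact) operators on $H$. Let $M=\{M_m\}_m$ be a positive instrument: each $M_m$ is a bounded positive linear map on $\mathcal T(H)$, and $\Lambda_M(T):=\sum_m M_m(T)$ converges in trace norm for every $T\in\mathcal T(H)$ and satisfies $\mathrm{tr}\,\Lambda_M(T)=\mathrm{tr}\,T$. Let $\Lambda_M^\dagger:\mathcal B(H)\to\mathcal B(H)$ be the dual map, defined by $\mathrm{tr}[T\Lambda_M^\dagger(A)]=\mathrm{tr}[\Lambda_M(T)A]$ for all $T\in\mathcal T(H)$. For a state $\rho$ (that is, $\rho\in\mathcal T(H)$, $\rho\ge 0$, $\mathrm{tr}\,\rho=1$) write $\langle A\rangle_\rho=\mathrm{tr}[\rho A]$, and define $$\mathrm{Inv}_M(\rho)=\|\Lambda_M(\rho)-\rho\|_1,\qquad \delta_M(A)=\Lambda_M^\dagger(A)-A\quad(A\in\mathcal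 B(H)),$$ $$\Delta_M(A;\rho)=\sup_{\substack{f\in C_0(\sigma(A))\\ f(A)\neq 0}}\frac{|\langle\delta_M(f(A))\rangle_\rho|}{\|f(A)\|}\quad(A\in\mathcal K_{\mathrm{sa}}(H)),$$ where $C_0(\sigma(A))$ is the space of complex-valued continuous functions on the spectrum $\sigma(A)$ of $A$ that vanish at infinity (since $\sigma(A)$ is compact, these are all the continuous functions) and $f(A)$ is given by the continuous functional calculus. Then, for every state $\rho$, each supremum $\Delta_M(A;\rho)$, $A\in\mathcal K_{\mathrm{sa}}(H)$, is finite, and $$\mathrm{Inv}_M(\rho)=\sup_{A\in\mathcal K(H)\setminus\{0\}}\frac{|\langle\delta_M(A)\rangle_\rho|}{\|A\|}=\sup_{A\in\mathcal K_{\mathrm{sa}}(H)}\Delta_M(A;\rho).$$ -/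

import Mathlib

namespace TraceClassOps

open scoped ENNReal ComplexOrder InnerProductSpace

section

variable {H : Type*} [NormedAddCommGroup H] [InnerProductSpace ℂ H] [CompleteSpace H]

variable (H) in
/-- The index set of a fixed Hilbert basis of `H`. -/
noncomputable def BasisIndex : Set H := (exists_hilbertBasis ℂ H).choose

variable (H) in
/-- A fixed Hilbert basis of `H`. -/
noncomputable def basis : HilbertBasis (BasisIndex H) ℂ H :=
  (exists_hilbertBasis ℂ H).choose_spec.choose

/-- The trace norm `tr |T| = ∑ᵢ ⟨eᵢ, |T| eᵢ⟩ ∈ [0, ∞]` of a bounded operator, `|T| = (T* T)^{1/2}`. -/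
noncomputable def eTraceNorm (T : H →L[ℂ] H) : ℝ≥0∞ :=
  ∑' i, ENNReal.ofReal (RCLike.re ⟪basis H i, CFC.abs T (basis H i)⟫_ℂ)

/-- The trace `tr T = ∑ᵢ ⟨eᵢ, T eᵢ⟩`. -/
noncomputable def trace (T : H →L[ℂ] H) : ℂ := ∑' i, ⟪basis H i, T (basis H i)⟫_ℂ

/-- Squared Hilbert-Schmidt norm (auxiliary). -/
noncomputable def hs (S : H →L[ℂ] H) : ℝ≥0∞ := ∑' i, ‖S (basis H i)‖ₑ ^ 2

lemma parseval (x : H) : ∑' i, ‖⟪basis H i, x⟫_ℂ‖ₑ ^ 2 = ‖x‖ₑ ^ 2 := by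
  have h := (basis H).hasSum_inner_mul_inner x x
  have h2 : HasSum (fun i => ‖⟪basis H i, x⟫_ℂ‖ ^ 2) (‖x‖ ^ 2) := by
    have := Complex.hasSum_re h
    convert this using 1
    · funext i
      rw [← inner_conj_symm x, ← Complex.normSq_eq_conj_mul_self, Complex.ofReal_re,
        Complex.normSq_eq_norm_sq]
    · rw [inner_self_eq_norm_sq_to_K]
      norm_cast
  have h3 := ENNReal.ofReal_tsum_of_nonneg (fun i => sq_nonneg ‖⟪basis H i, x⟫_ℂ‖) h2.summable
  rw [h2.tsum_eq] at h3
  simp only [ENNReal.ofReal_pow (norm_nonneg _), ofReal_norm] at h3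
  exact h3.symm

lemma hs_adjoint (S : H →L[ℂ] H) : hs (star S) = hs S := by
  unfold hs
  simp_rw [← parseval (S _), ← parseval (star S _)]
  rw [ENNReal.tsum_comm]
  refine tsum_congr fun i => tsum_congr fun j => ?_
  rw [ContinuousLinearMap.star_eq_adjoint, ContinuousLinearMap.adjoint_inner_right,
    ← inner_conj_symm, RCLike.enorm_conj]

lemma hs_mul_left (C S : H →L[ℂ] H) : hs (C * S) ≤ ‖C‖ₑ ^ 2 * hs S := by
  unfold hs
  rw [← ENNReal.tsum_mul_left]
  refine ENNReal.tsum_le_tsum fun i => ?_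
  rw [← mul_pow]
  gcongr
  exact C.le_opENorm _

lemma hs_mul_right (S C : H →L[ℂ] H) : hs (S * C) ≤ ‖C‖ₑ ^ 2 * hs S := by
  rw [← hs_adjoint, star_mul, ← hs_adjoint S]
  refine (hs_mul_left _ _).trans_eq ?_
  rw [← ofReal_norm, norm_star, ofReal_norm]

lemma holder {ι : Type*} (f g : ι → ℝ≥0∞) :
    ∑' i, f i * g i ≤ (∑' i, f i ^ 2) ^ (1 / 2 : ℝ) * (∑' i, g i ^ 2) ^ (1 / 2 : ℝ) := by
  rw [ENNReal.tsum_eq_iSup_sum]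
  refine iSup_le fun s => ?_
  have h := ENNReal.inner_le_Lp_mul_Lq s f g Real.HolderConjugate.two_two
  refine h.trans ?_
  have e : ∀ u : ℝ≥0∞, u ^ (2 : ℝ) = u ^ 2 := fun u => by
    rw [← ENNReal.rpow_natCast]; norm_num
  simp only [e]
  gcongr <;> exact ENNReal.sum_le_tsum s

lemma tsum_inner_mul_le (X Y : H →L[ℂ] H) :
    ∑' i, ‖⟪basis H i, (X * Y) (basis H i)⟫_ℂ‖ₑ ≤ hs X ^ (1 / 2 : ℝ) * hs Y ^ (1 / 2 : ℝ) := by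
  rw [← hs_adjoint X]
  refine le_trans (ENNReal.tsum_le_tsum fun i => ?_)
    (holder (fun i => ‖star X (basis H i)‖ₑ) (fun i => ‖Y (basis H i)‖ₑ))
  rw [mul_apply_eq_comp, ← ContinuousLinearMap.adjoint_inner_left,
    ContinuousLinearMap.star_eq_adjoint]
  rw [← ofReal_norm, ← ofReal_norm, ← ofReal_norm, ← ENNReal.ofReal_mul (norm_nonneg _)]
  exact ENNReal.ofReal_le_ofReal (norm_inner_le_norm _ _)

lemma norm_abs_apply (T : H →L[ℂ] H) (x y : H) :
    ⟪CFC.abs T x, CFC.abs T y⟫_ℂ = ⟪T x, T y⟫_ℂ := by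
  have h := congrArg (fun Z : H →L[ℂ] H => ⟪x, Z y⟫_ℂ) (CFC.abs_mul_abs T)
  have hs : star (CFC.abs T) = CFC.abs T := (CFC.abs_nonneg T).isSelfAdjoint.star_eq
  simp only [mul_apply_eq_comp] at h
  rw [ContinuousLinearMap.star_eq_adjoint, ContinuousLinearMap.adjoint_inner_right] at h
  rw [← h, ← ContinuousLinearMap.adjoint_inner_right, ← ContinuousLinearMap.star_eq_adjoint, hs]

lemma polar (T : H →L[ℂ] H) :
    ∃ U : H →L[ℂ] H, ‖U‖ₑ ≤ 1 ∧ T = U * CFC.abs T ∧ CFC.abs T = star U * T := by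
  have hn : ∀ x, ‖T x‖ = ‖CFC.abs T x‖ := fun x => by
    have := norm_abs_apply T x x
    rw [inner_self_eq_norm_sq_to_K, inner_self_eq_norm_sq_to_K] at this
    have h2 : ‖CFC.abs T x‖ ^ 2 = ‖T x‖ ^ 2 := by exact_mod_cast this
    exact ((sq_eq_sq₀ (norm_nonneg _) (norm_nonneg _)).1 h2).symm
  set K : Submodule ℂ H := (LinearMap.range (CFC.abs T).toLinearMap).topologicalClosure with hK
  have hc : IsClosed (K : Set H) := Submodule.isClosed_topologicalClosure _
  have : CompleteSpace K := hc.completeSpace_coe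
  have hmem : ∀ x, CFC.abs T x ∈ K := fun x =>
    Submodule.le_topologicalClosure _ (LinearMap.mem_range_self (CFC.abs T).toLinearMap x)
  let e : H →ₗ[ℂ] K := (CFC.abs T).toLinearMap.codRestrict K hmem
  have hd : DenseRange e := by
    intro y
    rw [closure_subtype]
    have : (Subtype.val '' Set.range e) = (LinearMap.range (CFC.abs T).toLinearMap : Set H) := by
      ext z; simp [e]
    rw [this]
    exact y.2
  have hb : ∀ x, ‖T.toLinearMap x‖ ≤ 1 * ‖e x‖ := fun x => by
    rw [one_mul]; exact (hn x).le
  let V : K →L[ℂ] H := T.toLinearMap.extendOfNorm e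
  have hV : ∀ x, V (e x) = T x := LinearMap.extendOfNorm_eq hd ⟨1, hb⟩
  have hVn : ∀ y, ‖V y‖ ≤ 1 * ‖y‖ := LinearMap.norm_extendOfNorm_apply_le hd 1 hb
  refine ⟨V ∘L K.orthogonalProjectionOnto, ?_, ?_, ?_⟩
  · rw [← ofReal_norm, ENNReal.ofReal_le_one]
    refine ContinuousLinearMap.opNorm_le_bound _ zero_le_one fun x => ?_
    refine (hVn _).trans ?_
    gcongr
    exact K.norm_orthogonalProjectionOnto_apply_le x
  · ext x
    have : K.orthogonalProjectionOnto (CFC.abs T x) = e x :=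
      K.orthogonalProjectionOnto_mem_subspace_eq_self (e x)
    simp [this, hV]
  · ext x
    refine ext_inner_right ℂ fun y => ?_
    rw [mul_apply_eq_comp, ContinuousLinearMap.star_eq_adjoint,
      ContinuousLinearMap.adjoint_inner_left, ContinuousLinearMap.comp_apply]
    have h1 : ∀ k : K, ⟪T x, V k⟫_ℂ = ⟪CFC.abs T x, (k : H)⟫_ℂ := by
      intro k
      refine hd.induction (P := fun k => ⟪T x, V k⟫_ℂ = ⟪CFC.abs T x, (k : H)⟫_ℂ) ?_
        (isClosed_eq (by fun_prop) (by fun_prop)) k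
      rintro _ ⟨z, rfl⟩
      rw [hV]
      exact (norm_abs_apply T x z).symm
    rw [h1]
    exact (K.inner_orthogonalProjectionOnto_eq_of_mem_left ⟨_, hmem x⟩ y).symm


lemma eTraceNorm_eq_hs (T : H →L[ℂ] H) : eTraceNorm T = hs (CFC.sqrt (CFC.abs T)) := by
  unfold eTraceNorm hs
  refine tsum_congr fun i => ?_
  have h := congrArg (fun Z : H →L[ℂ] H => ⟪basis H i, Z (basis H i)⟫_ℂ)
    (CFC.sqrt_mul_sqrt_self (CFC.abs T) (CFC.abs_nonneg T))
  have hs : star (CFC.sqrt (CFC.abs T)) = CFC.sqrt (CFC.abs T) :=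
    (CFC.sqrt_nonneg (CFC.abs T)).isSelfAdjoint.star_eq
  simp only [mul_apply_eq_comp] at h
  rw [← h, ← ContinuousLinearMap.adjoint_inner_left, ← ContinuousLinearMap.star_eq_adjoint, hs,
    inner_self_eq_norm_sq, ENNReal.ofReal_pow (norm_nonneg _), ofReal_norm]

lemma ofReal_re_le (z : ℂ) : ENNReal.ofReal (RCLike.re z) ≤ ‖z‖ₑ := by
  rw [← ofReal_norm]
  exact ENNReal.ofReal_le_ofReal (RCLike.re_le_norm z)

lemma enorm_star_le {U : H →L[ℂ] H} (h : ‖U‖ₑ ≤ 1) : ‖star U‖ₑ ≤ 1 := by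
  rwa [← ofReal_norm, norm_star, ofReal_norm]

lemma hs_contraction_mul {U X : H →L[ℂ] H} (h : ‖U‖ₑ ≤ 1) : hs (U * X) ≤ hs X := by
  refine (hs_mul_left _ _).trans ?_
  calc ‖U‖ₑ ^ 2 * hs X ≤ 1 ^ 2 * hs X := by gcongr
    _ = hs X := by simp

lemma eTraceNorm_mul_le (X Y : H →L[ℂ] H) :
    eTraceNorm (X * Y) ≤ hs X ^ (1 / 2 : ℝ) * hs Y ^ (1 / 2 : ℝ) := by
  obtain ⟨U, hU, -, h⟩ := polar (X * Y)
  unfold eTraceNorm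
  rw [h, ← mul_assoc]
  refine (ENNReal.tsum_le_tsum fun i => ofReal_re_le _).trans ((tsum_inner_mul_le _ _).trans ?_)
  gcongr
  exact hs_contraction_mul (enorm_star_le hU)

lemma half_mul (c a : ℝ≥0∞) : (c ^ 2 * a) ^ (1 / 2 : ℝ) = c * a ^ (1 / 2 : ℝ) := by
  rw [ENNReal.mul_rpow_of_nonneg _ _ (by norm_num), ← ENNReal.rpow_natCast, ← ENNReal.rpow_mul]
  norm_num

lemma half_mul_half (a : ℝ≥0∞) : a ^ (1 / 2 : ℝ) * a ^ (1 / 2 : ℝ) = a := by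
  rw [← ENNReal.rpow_add_of_nonneg _ _ (by norm_num) (by norm_num)]
  norm_num

/-- Every operator factors as `(U S) S` with `S = |T|^{1/2}` and a contraction `U`. -/
lemma factor (T : H →L[ℂ] H) : ∃ X Y : H →L[ℂ] H, T = X * Y ∧
    hs X ≤ eTraceNorm T ∧ hs Y ≤ eTraceNorm T := by
  obtain ⟨U, hU, h, -⟩ := polar T
  refine ⟨U * CFC.sqrt (CFC.abs T), CFC.sqrt (CFC.abs T), ?_, ?_, ?_⟩
  · rw [mul_assoc, CFC.sqrt_mul_sqrt_self (CFC.abs T) (CFC.abs_nonneg T)]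
    exact h
  · rw [eTraceNorm_eq_hs]
    exact hs_contraction_mul hU
  · rw [eTraceNorm_eq_hs]

lemma eTraceNorm_mul_mul_le (C T D : H →L[ℂ] H) :
    eTraceNorm (C * T * D) ≤ ‖C‖ₑ * ‖D‖ₑ * eTraceNorm T := by
  obtain ⟨X, Y, h, hX, hY⟩ := factor T
  calc eTraceNorm (C * T * D) = eTraceNorm ((C * X) * (Y * D)) := by rw [h]; simp only [mul_assoc]
    _ ≤ hs (C * X) ^ (1 / 2 : ℝ) * hs (Y * D) ^ (1 / 2 : ℝ) := eTraceNorm_mul_le _ _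
    _ ≤ (‖C‖ₑ ^ 2 * eTraceNorm T) ^ (1 / 2 : ℝ) * (‖D‖ₑ ^ 2 * eTraceNorm T) ^ (1 / 2 : ℝ) := by
        gcongr
        · exact (hs_mul_left _ _).trans (by gcongr)
        · exact (hs_mul_right _ _).trans (by gcongr)
    _ = ‖C‖ₑ * ‖D‖ₑ * (eTraceNorm T ^ (1 / 2 : ℝ) * eTraceNorm T ^ (1 / 2 : ℝ)) := by
        rw [half_mul, half_mul]; ring
    _ = _ := by rw [half_mul_half]

lemma eTraceNorm_mul_le_left (C T : H →L[ℂ] H) : eTraceNorm (C * T) ≤ ‖C‖ₑ * eTraceNorm T := by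
  rcases subsingleton_or_nontrivial H with hH | hH
  · have : C * T = 0 := Subsingleton.elim _ _
    simp [this, eTraceNorm]
  · have := eTraceNorm_mul_mul_le C T 1
    simpa using this

lemma eTraceNorm_mul_le_right (T D : H →L[ℂ] H) : eTraceNorm (T * D) ≤ ‖D‖ₑ * eTraceNorm T := by
  rcases subsingleton_or_nontrivial H with hH | hH
  · have : T * D = 0 := Subsingleton.elim _ _
    simp [this, eTraceNorm]
  · have := eTraceNorm_mul_mul_le 1 T D
    simpa using this

lemma tsum_inner_le (T : H →L[ℂ] H) :
    ∑' i, ‖⟪basis H i, T (basis H i)⟫_ℂ‖ₑ ≤ eTraceNorm T := by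
  obtain ⟨X, Y, h, hX, hY⟩ := factor T
  calc _ = ∑' i, ‖⟪basis H i, (X * Y) (basis H i)⟫_ℂ‖ₑ := by rw [← h]
    _ ≤ hs X ^ (1 / 2 : ℝ) * hs Y ^ (1 / 2 : ℝ) := tsum_inner_mul_le X Y
    _ ≤ eTraceNorm T ^ (1 / 2 : ℝ) * eTraceNorm T ^ (1 / 2 : ℝ) := by gcongr
    _ = _ := half_mul_half _

lemma eTraceNorm_add_le (S T : H →L[ℂ] H) :
    eTraceNorm (S + T) ≤ eTraceNorm S + eTraceNorm T := by
  obtain ⟨U, hU, -, h⟩ := polar (S + T)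
  have key : ∀ Z : H →L[ℂ] H, ∑' i, ‖⟪basis H i, (star U * Z) (basis H i)⟫_ℂ‖ₑ ≤ eTraceNorm Z :=
    fun Z => (tsum_inner_le _).trans ((eTraceNorm_mul_le_left _ _).trans
      (mul_le_of_le_one_left' (enorm_star_le hU)))
  refine le_trans ?_ (add_le_add (key S) (key T))
  rw [← ENNReal.tsum_add]
  refine ENNReal.tsum_le_tsum fun i => ?_
  rw [h, mul_add, add_apply, inner_add_right]
  exact (ofReal_re_le _).trans (enorm_add_le _ _)

lemma eTraceNorm_smul_le (c : ℂ) (T : H →L[ℂ] H) :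
    eTraceNorm (c • T) ≤ ‖c‖ₑ * eTraceNorm T := by
  rcases subsingleton_or_nontrivial H with hH | hH
  · have : c • T = 0 := Subsingleton.elim _ _
    simp [this, eTraceNorm]
  · have := eTraceNorm_mul_le_left (c • (1 : H →L[ℂ] H)) T
    rw [smul_mul_assoc, one_mul] at this
    refine this.trans_eq ?_
    rw [enorm_smul]
    simp

lemma eTraceNorm_zero : eTraceNorm (0 : H →L[ℂ] H) = 0 := by simp [eTraceNorm]

lemma eTraceNorm_neg (T : H →L[ℂ] H) : eTraceNorm (-T) = eTraceNorm T := by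
  simp [eTraceNorm]

lemma inner_le_eTraceNorm (T : H →L[ℂ] H) (x y : H) :
    ‖⟪x, T y⟫_ℂ‖ₑ ≤ ‖x‖ₑ * ‖y‖ₑ * eTraceNorm T := by
  have h1 : ⟪x, T y⟫_ℂ = trace (T * InnerProductSpace.rankOne ℂ y x) := by
    unfold trace
    rw [← (basis H).tsum_inner_mul_inner x (T y)]
    refine tsum_congr fun i => ?_
    simp
  have h2 : ‖trace (T * InnerProductSpace.rankOne ℂ y x)‖ₑ ≤
      eTraceNorm (T * InnerProductSpace.rankOne ℂ y x) :=
    le_trans (enorm_tsum_le_tsum_enorm) (tsum_inner_le _)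
  rw [h1]
  refine h2.trans ((eTraceNorm_mul_le_right _ _).trans_eq ?_)
  rw [InnerProductSpace.enorm_rankOne, mul_comm ‖x‖ₑ]

lemma eq_zero_of_eTraceNorm {T : H →L[ℂ] H} (h : eTraceNorm T = 0) : T = 0 := by
  ext y
  have := inner_le_eTraceNorm T (T y) y
  rw [h, mul_zero, nonpos_iff_eq_zero, enorm_eq_zero, inner_self_eq_zero] at this
  simpa using this

lemma eTraceNorm_rankOne_le (x y : H) :
    eTraceNorm (InnerProductSpace.rankOne ℂ x y) ≤ ‖x‖ₑ * ‖y‖ₑ := by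
  obtain ⟨U, hU, -, h⟩ := polar (InnerProductSpace.rankOne ℂ x y)
  unfold eTraceNorm
  rw [h]
  have e : ∀ i, ‖⟪basis H i, (star U * InnerProductSpace.rankOne ℂ x y) (basis H i)⟫_ℂ‖ₑ =
      ‖⟪basis H i, star U x⟫_ℂ‖ₑ * ‖⟪basis H i, y⟫_ℂ‖ₑ := fun i => by
    rw [mul_apply_eq_comp, InnerProductSpace.rankOne_apply, map_smul, inner_smul_right, enorm_mul,
      mul_comm, ← inner_conj_symm y, RCLike.enorm_conj]
  refine (ENNReal.tsum_le_tsum fun i => (ofReal_re_le _).trans_eq (e i)).trans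
    ((holder _ _).trans ?_)
  rw [parseval, parseval]
  have e2 : ∀ c : ℝ≥0∞, (c ^ 2) ^ (1 / 2 : ℝ) = c := fun c => by simpa using half_mul c 1
  rw [e2, e2]
  gcongr
  refine ((star U).le_opENorm x).trans ?_
  exact mul_le_of_le_one_left' (enorm_star_le hU)

variable (H) in
/-- Trace class operators: the bounded operators with `tr |T| < ∞`. -/
noncomputable def traceClassSubmodule : Submodule ℂ (H →L[ℂ] H) where
  carrier := {T | eTraceNorm T < ∞}
  add_mem' {S T} hS hT := (eTraceNorm_add_le S T).trans_lt (ENNReal.add_lt_top.2 ⟨hS, hT⟩)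
  zero_mem' := by simp [eTraceNorm_zero]
  smul_mem' c T hT := (eTraceNorm_smul_le c T).trans_lt (ENNReal.mul_lt_top enorm_lt_top hT)

variable (H) in
/-- The space `T(H)` of trace class operators; it carries the trace norm (not the operator norm). -/
def TraceClass : Type _ := traceClassSubmodule H

namespace TraceClass

noncomputable instance : AddCommGroup (TraceClass H) :=
  inferInstanceAs (AddCommGroup (traceClassSubmodule H))

noncomputable instance : Module ℂ (TraceClass H) :=
  inferInstanceAs (Module ℂ (traceClassSubmodule H))

/-- The bounded operator underlying a trace class operator. -/
def toOp (T : TraceClass H) : H →L[ℂ] H := T.1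

instance : CoeOut (TraceClass H) (H →L[ℂ] H) := ⟨toOp⟩

@[ext] lemma ext {S T : TraceClass H} (h : S.toOp = T.toOp) : S = T := Subtype.ext h

lemma lt_top (T : TraceClass H) : eTraceNorm T.toOp < ∞ := T.2

@[simp] lemma toOp_add (S T : TraceClass H) : (S + T).toOp = S.toOp + T.toOp := rfl
@[simp] lemma toOp_zero : (0 : TraceClass H).toOp = 0 := rfl
@[simp] lemma toOp_neg (T : TraceClass H) : (-T).toOp = -T.toOp := rfl
@[simp] lemma toOp_sub (S T : TraceClass H) : (S - T).toOp = S.toOp - T.toOp := rfl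
@[simp] lemma toOp_smul (c : ℂ) (T : TraceClass H) : (c • T).toOp = c • T.toOp := rfl

/-- The trace norm `‖T‖₁ = tr |T|` as the norm of `T(H)`. -/
noncomputable instance : NormedAddCommGroup (TraceClass H) :=
  AddGroupNorm.toNormedAddCommGroup
    { toFun := fun T => (eTraceNorm T.toOp).toReal
      map_zero' := by simp [eTraceNorm_zero]
      add_le' := fun S T => by
        rw [← ENNReal.toReal_add S.lt_top.ne T.lt_top.ne]
        exact ENNReal.toReal_mono (ENNReal.add_lt_top.2 ⟨S.lt_top, T.lt_top⟩).ne
          (eTraceNorm_add_le _ _)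
      neg' := fun T => by rw [toOp_neg, eTraceNorm_neg]
      eq_zero_of_map_eq_zero' := fun T h => by
        rcases (ENNReal.toReal_eq_zero_iff _).1 h with h | h
        · exact ext (eq_zero_of_eTraceNorm h)
        · exact absurd h T.lt_top.ne }

lemma norm_def (T : TraceClass H) : ‖T‖ = (eTraceNorm T.toOp).toReal := rfl

lemma ofReal_norm_eq (T : TraceClass H) : ENNReal.ofReal ‖T‖ = eTraceNorm T.toOp :=
  ENNReal.ofReal_toReal T.lt_top.ne

noncomputable instance : NormedSpace ℂ (TraceClass H) where
  norm_smul_le c T := by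
    rw [norm_def, norm_def, ← toReal_enorm c, ← ENNReal.toReal_mul]
    exact ENNReal.toReal_mono (ENNReal.mul_lt_top enorm_lt_top T.lt_top).ne
      (eTraceNorm_smul_le c T.toOp)

/-- `|x⟩⟨y|` as a trace class operator. -/
noncomputable def rankOne (x y : H) : TraceClass H :=
  ⟨InnerProductSpace.rankOne ℂ x y,
    (eTraceNorm_rankOne_le x y).trans_lt (ENNReal.mul_lt_top enorm_lt_top enorm_lt_top)⟩

@[simp] lemma toOp_rankOne (x y : H) : (rankOne x y).toOp = InnerProductSpace.rankOne ℂ x y := rfl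

lemma norm_rankOne_le (x y : H) : ‖rankOne x y‖ ≤ ‖x‖ * ‖y‖ := by
  rw [norm_def, ← toReal_enorm x, ← toReal_enorm y, ← ENNReal.toReal_mul]
  exact ENNReal.toReal_mono (ENNReal.mul_lt_top enorm_lt_top enorm_lt_top).ne
    (eTraceNorm_rankOne_le x y)

lemma summable_trace {T : H →L[ℂ] H} (hT : eTraceNorm T < ∞) :
    Summable fun i => ⟪basis H i, T (basis H i)⟫_ℂ := by
  refine Summable.of_enorm ?_
  exact ((tsum_inner_le T).trans_lt hT).ne

lemma mul_lt_top (T : TraceClass H) (A : H →L[ℂ] H) : eTraceNorm (T.toOp * A) < ∞ :=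
  (eTraceNorm_mul_le_right _ _).trans_lt (ENNReal.mul_lt_top enorm_lt_top T.lt_top)

lemma norm_trace_mul_le (T : TraceClass H) (A : H →L[ℂ] H) :
    ‖trace (T.toOp * A)‖ ≤ ‖A‖ * ‖T‖ := by
  have h : ‖trace (T.toOp * A)‖ₑ ≤ ‖A‖ₑ * eTraceNorm T.toOp :=
    (enorm_tsum_le_tsum_enorm.trans (tsum_inner_le _)).trans (eTraceNorm_mul_le_right _ _)
  rw [norm_def, ← toReal_enorm, ← toReal_enorm A, ← ENNReal.toReal_mul]
  exact ENNReal.toReal_mono (ENNReal.mul_lt_top enorm_lt_top T.lt_top).ne h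

/-- The bounded functional `T ↦ tr[T A]` on `T(H)`. -/
noncomputable def traceMul (A : H →L[ℂ] H) : TraceClass H →L[ℂ] ℂ :=
  LinearMap.mkContinuous
    { toFun := fun T => trace (T.toOp * A)
      map_add' := fun S T => by
        unfold trace
        rw [← (summable_trace (S.mul_lt_top A)).tsum_add (summable_trace (T.mul_lt_top A))]
        simp [add_mul]
      map_smul' := fun c T => by
        unfold trace
        simp only [toOp_smul, smul_mul_assoc, smul_apply, inner_smul_right,
          tsum_mul_left, RingHom.id_apply, smul_eq_mul] }
    ‖A‖ fun T => norm_trace_mul_le T A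

@[simp] lemma traceMul_apply (A : H →L[ℂ] H) (T : TraceClass H) :
    traceMul A T = trace (T.toOp * A) := rfl

lemma trace_rankOne_mul (x y : H) (A : H →L[ℂ] H) :
    trace ((rankOne x y).toOp * A) = ⟪y, A x⟫_ℂ := by
  unfold trace
  rw [← ContinuousLinearMap.adjoint_inner_left, ← (basis H).tsum_inner_mul_inner]
  refine tsum_congr fun i => ?_
  rw [mul_apply_eq_comp, toOp_rankOne, InnerProductSpace.rankOne_apply, inner_smul_right,
    ContinuousLinearMap.adjoint_inner_left]

/-- `T` is the trace-norm limit of the finite rank operators `T P_F = ∑_{i ∈ F} |T eᵢ⟩⟨eᵢ|`. -/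
lemma tendsto_finiteRank (T : TraceClass H) :
    Filter.Tendsto (fun F : Finset (BasisIndex H) => ∑ i ∈ F, rankOne (T.toOp (basis H i)) (basis H i))
      Filter.atTop (nhds T) := by
  obtain ⟨X, Y, h, hX, hY⟩ := factor T.toOp
  have hX' : hs X < ∞ := hX.trans_lt T.lt_top
  have hY' : hs Y < ∞ := hY.trans_lt T.lt_top
  set P : Finset (BasisIndex H) → H →L[ℂ] H := fun F =>
    ∑ i ∈ F, InnerProductSpace.rankOne ℂ (basis H i) (basis H i) with hP
  have toOp_sum : ∀ F : Finset (BasisIndex H),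
      (∑ i ∈ F, rankOne (T.toOp (basis H i)) (basis H i)).toOp = T.toOp * P F := fun F => by
    classical
    induction F using Finset.induction_on with
    | empty => simp [hP]
    | insert a s ha ih =>
      rw [Finset.sum_insert ha, toOp_add, ih, hP]
      simp only [Finset.sum_insert ha, mul_add, toOp_rankOne]
      congr 1
      exact (InnerProductSpace.comp_rankOne _ _ _).symm
  classical
  have hPb : ∀ F j, P F (basis H j) = if j ∈ F then basis H j else 0 := fun F j => by
    classical
    have ho := (basis H).orthonormal
    simp only [hP, sum_apply, InnerProductSpace.rankOne_apply,
      orthonormal_iff_ite.1 ho, ite_smul, one_smul, zero_smul, Finset.sum_ite_eq']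
  have hsY : ∀ F, hs (Y - Y * P F) = ∑' i : {i // i ∉ F}, ‖Y (basis H i)‖ₑ ^ 2 := fun F => by
    classical
    have := tsum_subtype {i | i ∉ F} (fun i => ‖Y (basis H i)‖ₑ ^ 2)
    refine Eq.trans ?_ this.symm
    unfold hs
    refine tsum_congr fun i => ?_
    rw [sub_apply, mul_apply_eq_comp, hPb]
    by_cases hi : i ∈ F <;> simp [hi]
  have hlim : Filter.Tendsto (fun F => hs X ^ (1 / 2 : ℝ) * hs (Y - Y * P F) ^ (1 / 2 : ℝ))
      Filter.atTop (nhds 0) := by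
    have h0 := ENNReal.tendsto_tsum_compl_atTop_zero (f := fun i => ‖Y (basis H i)‖ₑ ^ 2) hY'.ne
    simp_rw [← hsY] at h0
    have h1 := (ENNReal.continuous_rpow_const (y := (1 / 2 : ℝ))).continuousAt.tendsto.comp h0
    have h2 := ENNReal.Tendsto.const_mul (a := hs X ^ (1 / 2 : ℝ)) h1
      (Or.inr (ENNReal.rpow_lt_top_of_nonneg (by norm_num) hX'.ne).ne)
    simpa using h2
  rw [tendsto_iff_norm_sub_tendsto_zero]
  have hlim' := (ENNReal.tendsto_toReal ENNReal.zero_ne_top).comp hlim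
  rw [ENNReal.toReal_zero] at hlim'
  refine squeeze_zero (fun _ => norm_nonneg _) (fun F => ?_) hlim'
  rw [norm_sub_rev, norm_def, toOp_sub, toOp_sum]
  refine ENNReal.toReal_mono ?_ ?_
  · refine (ENNReal.mul_lt_top (ENNReal.rpow_lt_top_of_nonneg (by norm_num) hX'.ne)
      (ENNReal.rpow_lt_top_of_nonneg (by norm_num) ?_)).ne
    rw [hsY]
    exact ((ENNReal.tsum_comp_le_tsum_of_injective Subtype.val_injective _).trans_lt hY').ne
  · have e : T.toOp - T.toOp * P F = X * (Y - Y * P F) := by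
      rw [h, mul_sub, mul_assoc]
    rw [e]
    exact eTraceNorm_mul_le _ _

/-- Every bounded functional on `T(H)` is `T ↦ tr[T D]` for exactly one bounded operator `D`. -/
theorem existsUnique_trace_mul (φ : TraceClass H →L[ℂ] ℂ) :
    ∃! D : H →L[ℂ] H, ∀ T : TraceClass H, trace (T.toOp * D) = φ T := by
  let B : H →L⋆[ℂ] H →L[ℂ] ℂ := LinearMap.mkContinuous₂
    (LinearMap.mk₂'ₛₗ (starRingEnd ℂ) (RingHom.id ℂ) (fun v w => φ (rankOne w v))
      (fun v v' w => by
        rw [← map_add]; congr 1; ext z; simp [inner_add_left, add_smul])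
      (fun c v w => by
        rw [smul_eq_mul, ← smul_eq_mul, ← map_smul]; congr 1; ext z; simp)
      (fun v w w' => by
        rw [← map_add]; congr 1; ext z; simp)
      (fun c v w => by
        rw [RingHom.id_apply, ← map_smul]; congr 1; ext z; simp))
    ‖φ‖ (fun v w => by
      refine (φ.le_opNorm _).trans ?_
      have := mul_le_mul_of_nonneg_left (norm_rankOne_le w v) (norm_nonneg φ)
      calc ‖φ‖ * ‖rankOne w v‖ ≤ ‖φ‖ * (‖w‖ * ‖v‖) := this
        _ = ‖φ‖ * ‖v‖ * ‖w‖ := by ring)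
  have hB : ∀ v w, B v w = φ (rankOne w v) := fun v w => rfl
  let D : H →L[ℂ] H := ContinuousLinearMap.adjoint (InnerProductSpace.continuousLinearMapOfBilin B)
  have hD : ∀ x y, trace ((rankOne x y).toOp * D) = φ (rankOne x y) := fun x y => by
    rw [trace_rankOne_mul, ContinuousLinearMap.adjoint_inner_right,
      InnerProductSpace.continuousLinearMapOfBilin_apply, hB]
  refine ⟨D, fun T => ?_, fun D' hD' => ?_⟩
  · have h1 := ((traceMul D).continuous.tendsto T).comp T.tendsto_finiteRank
    have h2 := (φ.continuous.tendsto T).comp T.tendsto_finiteRank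
    refine tendsto_nhds_unique (h1.congr fun F => ?_) h2
    simp only [Function.comp_apply, map_sum, traceMul_apply, hD]
  · ext x
    refine ext_inner_left ℂ fun y => ?_
    rw [← trace_rankOne_mul, ← trace_rankOne_mul, hD', hD]

end TraceClass


namespace TraceClass

lemma norm_of_nonneg {T : TraceClass H} (hT : 0 ≤ T.toOp) : ‖T‖ = (trace T.toOp).re := by
  have h0 : ∀ i, 0 ≤ RCLike.re ⟪basis H i, T.toOp (basis H i)⟫_ℂ := fun i =>
    ((ContinuousLinearMap.nonneg_iff_isPositive _).1 hT).re_inner_nonneg_right _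
  have hs := Complex.hasSum_re (summable_trace T.lt_top).hasSum
  rw [norm_def, eTraceNorm, CFC.abs_of_nonneg _ hT, trace, ← hs.tsum_eq,
    ENNReal.tsum_toReal_eq (fun _ => ENNReal.ofReal_ne_top)]
  exact tsum_congr fun i => ENNReal.toReal_ofReal (h0 i)

lemma isClosed_nonneg : IsClosed {T : TraceClass H | 0 ≤ T.toOp} := by
  have e : {T : TraceClass H | 0 ≤ T.toOp} =
      ⋂ x : H, (fun T : TraceClass H => traceMul (InnerProductSpace.rankOne ℂ x x) T) ⁻¹'
        {z : ℂ | 0 ≤ z} := by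
    ext T
    have h : ∀ x, trace (T.toOp * InnerProductSpace.rankOne ℂ x x) = ⟪x, T.toOp x⟫_ℂ := fun x => by
      unfold trace
      rw [← (basis H).tsum_inner_mul_inner x]
      refine tsum_congr fun i => ?_
      simp
    simp only [Set.mem_ofPred_eq, Set.mem_iInter, Set.mem_preimage, traceMul_apply, h]
    rw [ContinuousLinearMap.nonneg_iff_isPositive,
      ContinuousLinearMap.isPositive_iff_complex]
    refine forall_congr' fun x => ?_
    rw [← inner_conj_symm x, Complex.le_def]
    generalize ⟪T.toOp x, x⟫_ℂ = z
    simp only [Complex.zero_re, Complex.zero_im, Complex.conj_re, Complex.conj_im,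
      RCLike.re_eq_complex_re, Complex.ext_iff, Complex.ofReal_re, Complex.ofReal_im]
    constructor
    · rintro ⟨⟨-, h1⟩, h2⟩
      exact ⟨h2, by rw [← h1, neg_zero]⟩
    · rintro ⟨h1, h2⟩
      exact ⟨⟨trivial, by linarith⟩, h1⟩
  rw [e]
  refine isClosed_iInter fun x => IsClosed.preimage ?_ ?_
  · exact (traceMul _).continuous
  · exact isClosed_Ici

lemma eTraceNorm_star_le (T : H →L[ℂ] H) : eTraceNorm (star T) ≤ eTraceNorm T := by
  obtain ⟨U, hU, h, -⟩ := polar T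
  have hsa : star (CFC.abs T) = CFC.abs T := (CFC.abs_nonneg T).isSelfAdjoint.star_eq
  have e : star T = CFC.abs T * star U := by
    conv_lhs => rw [h]
    rw [star_mul, hsa]
  rw [e]
  refine (eTraceNorm_mul_le_right _ _).trans ((mul_le_of_le_one_left' (enorm_star_le hU)).trans ?_)
  rw [eTraceNorm, CFC.cfcAbs_cfcAbs, ← eTraceNorm]

/-- The adjoint of a trace class operator. -/
noncomputable def adj (T : TraceClass H) : TraceClass H :=
  ⟨star T.toOp, (eTraceNorm_star_le _).trans_lt T.lt_top⟩

lemma norm_adj_le (T : TraceClass H) : ‖T.adj‖ ≤ ‖T‖ :=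
  ENNReal.toReal_mono T.lt_top.ne (eTraceNorm_star_le _)

/-- The absolute value of a trace class operator. -/
noncomputable def absVal (T : TraceClass H) : TraceClass H :=
  ⟨CFC.abs T.toOp, by
    show eTraceNorm _ < ∞
    rw [eTraceNorm, CFC.cfcAbs_cfcAbs, ← eTraceNorm]
    exact T.lt_top⟩

lemma norm_absVal (T : TraceClass H) : ‖T.absVal‖ = ‖T‖ := by
  show (eTraceNorm (CFC.abs T.toOp)).toReal = _
  rw [eTraceNorm, CFC.cfcAbs_cfcAbs, ← eTraceNorm]
  rfl

lemma norm_half_le (S T : TraceClass H) (c : ℝ) (hS : ‖S‖ ≤ c) (hT : ‖T‖ ≤ c) (z w : ℂ)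
    (hz : ‖z‖ = 1 / 2) (hw : ‖w‖ = 1 / 2) : ‖z • S + w • T‖ ≤ c := by
  refine (norm_add_le _ _).trans ?_
  rw [norm_smul, norm_smul, hz, hw]
  linarith

lemma decomp_selfAdjoint (S : TraceClass H) (hS : IsSelfAdjoint S.toOp) :
    ∃ P Q : TraceClass H, 0 ≤ P.toOp ∧ 0 ≤ Q.toOp ∧ ‖P‖ ≤ ‖S‖ ∧ ‖Q‖ ≤ ‖S‖ ∧ S = P - Q := by
  refine ⟨(1 / 2 : ℂ) • S.absVal + (1 / 2 : ℂ) • S, (1 / 2 : ℂ) • S.absVal + (-1 / 2 : ℂ) • S,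
    ?_, ?_, norm_half_le _ _ _ (norm_absVal S).le le_rfl _ _ (by norm_num) (by norm_num),
    norm_half_le _ _ _ (norm_absVal S).le le_rfl _ _ (by norm_num) (by norm_num), ?_⟩
  · have e : ((1 / 2 : ℂ) • S.absVal + (1 / 2 : ℂ) • S).toOp = (S.toOp)⁺ := by
      have h := CFC.abs_add_self S.toOp hS
      show (1 / 2 : ℂ) • CFC.abs S.toOp + (1 / 2 : ℂ) • S.toOp = _
      rw [← smul_add, h, two_smul, ← two_smul ℂ, smul_smul]
      norm_num
    rw [e]
    exact CFC.posPart_nonneg _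
  · have e : ((1 / 2 : ℂ) • S.absVal + (-1 / 2 : ℂ) • S).toOp = (S.toOp)⁻ := by
      have h := CFC.abs_sub_self S.toOp hS
      have e1 : (1 / 2 : ℂ) • CFC.abs S.toOp + (-1 / 2 : ℂ) • S.toOp =
        (1 / 2 : ℂ) • (CFC.abs S.toOp - S.toOp) := by module
      show (1 / 2 : ℂ) • CFC.abs S.toOp + (-1 / 2 : ℂ) • S.toOp = _
      rw [e1, h, two_smul, ← two_smul ℂ, smul_smul]
      norm_num
    rw [e]
    exact CFC.negPart_nonneg _
  · module

lemma decomp (T : TraceClass H) : ∃ P Q R S : TraceClass H,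
    (0 ≤ P.toOp ∧ 0 ≤ Q.toOp ∧ 0 ≤ R.toOp ∧ 0 ≤ S.toOp) ∧
    (‖P‖ ≤ ‖T‖ ∧ ‖Q‖ ≤ ‖T‖ ∧ ‖R‖ ≤ ‖T‖ ∧ ‖S‖ ≤ ‖T‖) ∧
    T = (P - Q) + Complex.I • (R - S) := by
  set X : TraceClass H := (1 / 2 : ℂ) • T + (1 / 2 : ℂ) • T.adj with hX
  set Y : TraceClass H := (-Complex.I / 2) • T + (Complex.I / 2) • T.adj with hY
  have hadj : T.adj.toOp = star T.toOp := rfl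
  have sX : IsSelfAdjoint X.toOp := by
    rw [IsSelfAdjoint, hX]
    simp [hadj, star_smul, add_comm]
  have sY : IsSelfAdjoint Y.toOp := by
    rw [IsSelfAdjoint, hY]
    simp [hadj, star_smul, add_comm]
  obtain ⟨P, Q, hP, hQ, nP, nQ, h1⟩ := decomp_selfAdjoint X sX
  obtain ⟨R, S, hR, hS, nR, nS, h2⟩ := decomp_selfAdjoint Y sY
  have nX : ‖X‖ ≤ ‖T‖ := norm_half_le _ _ _ le_rfl (norm_adj_le T) _ _ (by norm_num) (by norm_num)
  have nY : ‖Y‖ ≤ ‖T‖ := norm_half_le _ _ _ le_rfl (norm_adj_le T) _ _ (by norm_num) (by norm_num)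
  refine ⟨P, Q, R, S, ⟨hP, hQ, hR, hS⟩,
    ⟨nP.trans nX, nQ.trans nX, nR.trans nY, nS.trans nY⟩, ?_⟩
  have e1 : Complex.I * (-Complex.I / 2) = 1 / 2 := by
    linear_combination (-1 / 2 : ℂ) * Complex.I_mul_I
  have e2 : Complex.I * (Complex.I / 2) = -1 / 2 := by
    linear_combination (1 / 2 : ℂ) * Complex.I_mul_I
  rw [← h1, ← h2, hX, hY, smul_add, smul_smul, smul_smul, e1, e2]
  module

lemma norm_le_of_positive_tracePreserving (L : TraceClass H →ₗ[ℂ] TraceClass H)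
    (hpos : ∀ T : TraceClass H, 0 ≤ T.toOp → 0 ≤ (L T).toOp)
    (htr : ∀ T : TraceClass H, trace (L T).toOp = trace T.toOp) (T : TraceClass H) :
    ‖L T‖ ≤ 4 * ‖T‖ := by
  obtain ⟨P, Q, R, S, ⟨hP, hQ, hR, hS⟩, ⟨nP, nQ, nR, nS⟩, h⟩ := T.decomp
  have key : ∀ Z : TraceClass H, 0 ≤ Z.toOp → ‖L Z‖ = ‖Z‖ := fun Z hZ => by
    rw [norm_of_nonneg (hpos Z hZ), norm_of_nonneg hZ, htr]
  have e : L T = (L P - L Q) + Complex.I • (L R - L S) := by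
    conv_lhs => rw [h]
    simp
  rw [e]
  have h1 := norm_add_le (L P - L Q) (Complex.I • (L R - L S))
  have h2 := norm_sub_le (L P) (L Q)
  have h3 := norm_sub_le (L R) (L S)
  rw [norm_smul, Complex.norm_I, one_mul] at h1
  rw [key P hP, key Q hQ] at h2
  rw [key R hR, key S hS] at h3
  linarith

end TraceClass

/-- A density operator: positive with unit trace. -/
def IsState (ρ : TraceClass H) : Prop := 0 ≤ ρ.toOp ∧ trace ρ.toOp = 1

/-- The expectation value `⟨A⟩_ρ = tr[ρ A]`. -/
noncomputable def expectation (ρ : TraceClass H) (A : H →L[ℂ] H) : ℂ := trace (ρ.toOp * A)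

variable (H) in
/-- A positive instrument with discrete outcome set `ι`: bounded positive linear maps `M_m` on
`T(H)` whose sum (in trace norm, pointwise on `T(H)`) preserves the trace. -/
structure Instrument (ι : Type*) where
  op : ι → TraceClass H →L[ℂ] TraceClass H
  op_nonneg : ∀ (m : ι) (T : TraceClass H), 0 ≤ T.toOp → 0 ≤ (op m T).toOp
  summable_op : ∀ T : TraceClass H, Summable fun m => op m T
  trace_tsum_op : ∀ T : TraceClass H, trace (∑' m, op m T).toOp = trace T.toOp

/-- The Heisenberg dual `Λ† : B(H) → B(H)` of a bounded map `Λ` on `T(H)`: `Λ†(A)` is the unique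
bounded operator with `tr[T Λ†(A)] = tr[Λ(T) A]` for all `T ∈ T(H)`. -/
noncomputable def heisenbergDual (L : TraceClass H →L[ℂ] TraceClass H) (A : H →L[ℂ] H) :
    H →L[ℂ] H :=
  (TraceClass.existsUnique_trace_mul ((TraceClass.traceMul A).comp L)).choose

lemma trace_mul_heisenbergDual (L : TraceClass H →L[ℂ] TraceClass H) (A : H →L[ℂ] H)
    (T : TraceClass H) : trace (T.toOp * heisenbergDual L A) = trace ((L T).toOp * A) :=
  (TraceClass.existsUnique_trace_mul ((TraceClass.traceMul A).comp L)).choose_spec.1 T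

namespace Instrument

variable {ι : Type*}

/-- The non-selective process `Λ_M = ∑ₘ M_m`, a bounded linear map on `T(H)`. -/
noncomputable def nonselective (M : Instrument H ι) : TraceClass H →L[ℂ] TraceClass H :=
  LinearMap.mkContinuous
    { toFun := fun T => ∑' m, M.op m T
      map_add' := fun S T => by
        simp only [map_add]
        exact (M.summable_op S).tsum_add (M.summable_op T)
      map_smul' := fun c T => by
        simp only [map_smul, RingHom.id_apply]
        exact (M.summable_op T).tsum_const_smul c }
    4 (TraceClass.norm_le_of_positive_tracePreserving _
      (fun T hT => TraceClass.isClosed_nonneg.mem_of_tendsto (M.summable_op T).hasSum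
        (Filter.Eventually.of_forall fun F => by
          classical
          show 0 ≤ (∑ m ∈ F, M.op m T).toOp
          induction F using Finset.induction_on with
          | empty => simp
          | insert a s ha ih =>
            rw [Finset.sum_insert ha, TraceClass.toOp_add]
            exact add_nonneg (M.op_nonneg a T hT) ih))
      M.trace_tsum_op)

/-- The invasiveness `Inv_M(ρ) = ‖Λ_M(ρ) - ρ‖₁` (trace norm). -/
noncomputable def invasiveness (M : Instrument H ι) (ρ : TraceClass H) : ℝ :=
  ‖M.nonselective ρ - ρ‖

/-- The disturbance operator `δ_M(A) = Λ_M†(A) - A`. -/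
noncomputable def disturbance (M : Instrument H ι) (A : H →L[ℂ] H) : H →L[ℂ] H :=
  heisenbergDual M.nonselective A - A

/-- The normalized disturbances `|⟨δ_M(f(A))⟩_ρ| / ‖f(A)‖` for `f ∈ C₀(σ(A))` with `f(A) ≠ 0`, where
`f(A)` is the continuous functional calculus of the self-adjoint operator `A`. -/
def functionRatios (M : Instrument H ι) (A : H →L[ℂ] H) (hA : IsSelfAdjoint A)
    (ρ : TraceClass H) : Set ℝ :=
  {r | ∃ f : ZeroAtInftyContinuousMap (spectrum ℂ A) ℂ,
    cfcHom (R := ℂ) hA.isStarNormal (f : C(spectrum ℂ A, ℂ)) ≠ 0 ∧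
    r = ‖expectation ρ (M.disturbance (cfcHom (R := ℂ) hA.isStarNormal (f : C(spectrum ℂ A, ℂ))))‖ /
      ‖cfcHom (R := ℂ) hA.isStarNormal (f : C(spectrum ℂ A, ℂ))‖}

/-- The maximum disturbance `Δ_M(A; ρ)`. -/
noncomputable def maxDisturbance (M : Instrument H ι) (A : H →L[ℂ] H) (hA : IsSelfAdjoint A)
    (ρ : TraceClass H) : ℝ :=
  sSup (M.functionRatios A hA ρ)

end Instrument

end

end TraceClassOps

namespace TraceClassOps

open scoped ENNReal ComplexOrder InnerProductSpace

section

variable {H : Type*} [NormedAddCommGroup H] [InnerProductSpace ℂ H] [CompleteSpace H]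

/-! By duality the expected disturbance of `A` in the state `ρ` is `tr[T A]`, where `T = Λ_M(ρ) -
ρ`. Hölder's inequality for the trace gives `|tr[T A]| ≤ ‖T‖₁ ‖A‖` for every bounded `A`, hence all
the upper bounds at once, including those for the operators `f(A)`, which need not be compact.

Conversely, `T` is self-adjoint because `ρ` and `Λ_M(ρ)` are positive. The natural optimiser is the
sign of `T`, since `T sgn(T) = |T|`, but it is in general neither compact nor a continuous function
of `T`. It is replaced by `A = T (|T| + ε)⁻¹`. This is a self-adjoint contraction, compact because
`T` is, and `T A = T² (|T| + ε)⁻¹` satisfies both `T A ≥ 0` and `T A ≥ |T| - ε`. Finitely many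
diagonal entries of `|T|` already come close to `‖T‖₁`; on these the loss is `ε` each, and the other
entries of `T A` are nonnegative. So `tr[T A]` comes as close to `‖T‖₁` as desired
(`exists_isCompactOperator_lt_trace_mul`).

These near-optimal operators are compact and self-adjoint, so they serve both suprema: in the second
one, taking `f` to be the identity on the spectrum recovers `A` itself. -/

omit [CompleteSpace H] in
lemma isCompactOperator_rankOne (x y : H) :
    IsCompactOperator (InnerProductSpace.rankOne ℂ x y : H →L[ℂ] H) :=
  ((isCompactOperator_id (E := ℂ)).clm_comp (ContinuousLinearMap.toSpanSingleton ℂ x)).comp_clm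
    (innerSL ℂ y)

/-! ### Compactness of trace class operators and compact approximation of the trace norm -/

namespace TraceClass

/-- Pairing `T x` with itself gives `‖T x‖² ≤ ‖T x‖ ‖x‖ ‖T‖₁`, and one factor `‖T x‖` cancels unless
it is zero. -/
lemma opNorm_toOp_le (T : TraceClass H) : ‖T.toOp‖ ≤ ‖T‖ := by
  refine ContinuousLinearMap.opNorm_le_bound _ (norm_nonneg T) fun x => ?_
  have h := inner_le_eTraceNorm T.toOp (T.toOp x) x
  rw [← ofReal_norm_eq, ← ofReal_norm, ← ofReal_norm, ← ofReal_norm,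
    ← ENNReal.ofReal_mul (by positivity), ← ENNReal.ofReal_mul (by positivity),
    ENNReal.ofReal_le_ofReal_iff (by positivity), inner_self_eq_norm_sq_to_K] at h
  simp only [Complex.coe_algebraMap, norm_pow, Complex.norm_real, norm_norm] at h
  rcases (norm_nonneg (T.toOp x)).eq_or_lt with h0 | h0
  · rw [← h0]; positivity
  · nlinarith

/-- The trace norm dominates the operator norm, so approximation by finite rank operators in trace
norm is also approximation in operator norm, and compactness survives such limits. -/
lemma isCompactOperator_toOp (T : TraceClass H) : IsCompactOperator T.toOp := by
  let toOpL : TraceClass H →L[ℂ] H →L[ℂ] H := LinearMap.mkContinuous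
    { toFun := toOp, map_add' := toOp_add, map_smul' := toOp_smul } 1
    fun T => by simpa using T.opNorm_toOp_le
  refine isCompactOperator_of_tendsto ((toOpL.continuous.tendsto T).comp T.tendsto_finiteRank)
    (Filter.Eventually.of_forall fun F => ?_)
  simp only [Function.comp_apply, map_sum]
  exact (compactOperator (RingHom.id ℂ) H H).sum_mem fun i _ => isCompactOperator_rankOne _ _

/-- The trace norm of a self-adjoint trace class operator is approximated by its pairings with
self-adjoint compact contractions. -/
lemma exists_isCompactOperator_lt_trace_mul (T : TraceClass H) (hT : IsSelfAdjoint T.toOp)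
    {c : ℝ} (hc : c < ‖T‖) : ∃ A : H →L[ℂ] H, IsSelfAdjoint A ∧ IsCompactOperator A ∧ ‖A‖ ≤ 1 ∧
      c < ‖trace (T.toOp * A)‖ := by
  have hpos := (ContinuousLinearMap.nonneg_iff_isPositive _).1 (CFC.abs_nonneg T.toOp)
  -- The diagonal entries of `|T|` sum to `‖T‖₁ > c`, so some finite partial sum already exceeds
  -- `c`.
  obtain ⟨F, hF⟩ : ∃ F : Finset (BasisIndex H),
      c < ∑ i ∈ F, RCLike.re ⟪basis H i, CFC.abs T.toOp (basis H i)⟫_ℂ := by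
    have h := norm_of_nonneg (T := T.absVal) (CFC.abs_nonneg T.toOp)
    have hs := Complex.hasSum_re (summable_trace T.absVal.lt_top).hasSum
    rw [norm_absVal] at h
    rw [← trace, ← h] at hs
    exact (hs.eventually_const_lt hc).exists
  -- `ε` is chosen after `F`: a loss of `ε` on each entry indexed by `F` must stay below the slack.
  obtain ⟨ε, hε, hεF⟩ : ∃ ε : ℝ, 0 < ε ∧ F.card * ε <
      ∑ i ∈ F, RCLike.re ⟪basis H i, CFC.abs T.toOp (basis H i)⟫_ℂ - c := by
    refine exists_pos_mul_lt (sub_pos.2 hF) _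
  have hg : Continuous fun x : ℝ => (|x| + ε)⁻¹ :=
    Continuous.inv₀ (by fun_prop) fun x => by positivity
  have hf : Continuous fun x : ℝ => x * (|x| + ε)⁻¹ := continuous_id.mul hg
  -- A continuous substitute for the sign of `T`, keeping a factor `x` that will make it compact.
  set A : H →L[ℂ] H := cfc (fun x : ℝ => x * (|x| + ε)⁻¹) T.toOp with hA
  have hTA : T.toOp * A = cfc (fun x : ℝ => x * (x * (|x| + ε)⁻¹)) T.toOp := by
    rw [cfc_mul (fun x : ℝ => x) _ T.toOp (by fun_prop) hf.continuousOn, cfc_id' ℝ T.toOp]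
  have hTA0 : 0 ≤ T.toOp * A := by
    rw [hTA]
    refine cfc_nonneg fun x _ => ?_
    rw [← mul_assoc]
    exact mul_nonneg (mul_self_nonneg x) (by positivity)
  -- On the spectrum this is `|x| - ε ≤ x² / (|x| + ε)`, which amounts to `x² - ε² ≤ x²`.
  have hTAε : 0 ≤ T.toOp * A - (CFC.abs T.toOp - algebraMap ℝ _ ε) := by
    rw [hTA, CFC.abs_eq_cfc_norm T.toOp hT, ← cfc_const ε T.toOp,
      ← cfc_sub (fun x : ℝ => ‖x‖) _ T.toOp, sub_nonneg]
    refine cfc_mono (fun x _ => ?_) (by fun_prop) (continuous_id.mul hf).continuousOn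
    have h0 : 0 < |x| + ε := by positivity
    rw [Real.norm_eq_abs, ← mul_assoc, ← abs_mul_abs_self x, ← div_eq_mul_inv, le_div_iff₀ h0]
    nlinarith [sq_nonneg ε]
  refine ⟨A, cfc_predicate _ _, ?_, norm_cfc_le zero_le_one fun x _ => ?_, ?_⟩
  -- `A` is the compact operator `T` times the bounded operator `(|T| + ε)⁻¹`.
  · rw [hA, cfc_mul (fun x : ℝ => x) _ T.toOp (by fun_prop) hg.continuousOn, cfc_id' ℝ T.toOp]
    exact T.isCompactOperator_toOp.comp_clm _
  · rw [Real.norm_eq_abs, abs_mul, abs_inv, abs_of_pos (show 0 < |x| + ε by positivity),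
      ← div_eq_mul_inv]
    exact div_le_one_of_le₀ (by linarith) (by positivity)
  · have h1 : ∀ i, RCLike.re ⟪basis H i, CFC.abs T.toOp (basis H i)⟫_ℂ - ε ≤
        RCLike.re ⟪basis H i, (T.toOp * A) (basis H i)⟫_ℂ := fun i => by
      have h := ((ContinuousLinearMap.nonneg_iff_isPositive _).1 hTAε).re_inner_nonneg_right
        (basis H i)
      have hn : ‖basis H i‖ = 1 := (basis H).orthonormal.1 i
      have he : (algebraMap ℝ (H →L[ℂ] H) ε) (basis H i) = (ε : ℂ) • basis H i := by
        simp [Algebra.algebraMap_eq_smul_one]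
      rw [sub_apply, sub_apply, inner_sub_right, inner_sub_right, he, inner_smul_right,
        inner_self_eq_norm_sq_to_K, hn] at h
      simp only [map_sub, map_one, one_pow, mul_one, RCLike.re_eq_complex_re,
        Complex.ofReal_re] at h ⊢
      linarith
    have hs := Complex.hasSum_re (summable_trace (T.mul_lt_top A)).hasSum
    -- Since `T A ≥ 0`, the diagonal entries outside `F` can only increase the trace. Without this
    -- they would cost `ε` each, infinitely often when the dimension is infinite.
    have h2 := sum_le_hasSum F (fun i _ =>
      ((ContinuousLinearMap.nonneg_iff_isPositive _).1 hTA0).re_inner_nonneg_right (basis H i)) hs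
    have h3 := F.sum_le_sum fun i _ => h1 i
    rw [Finset.sum_sub_distrib, Finset.sum_const, nsmul_eq_mul] at h3
    have h4 := Complex.re_le_norm (trace (T.toOp * A))
    rw [← trace] at h2
    linarith

end TraceClass

/-! ### Disturbance ratios and the invasiveness -/

namespace Instrument

variable {ι : Type*}

/-- Finite partial sums are positive and the positive cone is closed in trace norm. This is what
makes `Λ_M(ρ) - ρ` self-adjoint. -/
lemma nonselective_nonneg (M : Instrument H ι) (T : TraceClass H) (hT : 0 ≤ T.toOp) :
    0 ≤ (M.nonselective T).toOp :=
  TraceClass.isClosed_nonneg.mem_of_tendsto (M.summable_op T).hasSum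
    (Filter.Eventually.of_forall fun _ =>
      Finset.sum_induction (fun m => M.op m T) (fun S => 0 ≤ S.toOp)
        (fun _ _ => add_nonneg) le_rfl fun m _ => M.op_nonneg m T hT)

/-- Duality moves the map from the observable to the state, so `ρ` enters only through `Λ_M(ρ) - ρ`,
whose trace norm is the invasiveness. -/
lemma expectation_disturbance (M : Instrument H ι) (ρ : TraceClass H) (A : H →L[ℂ] H) :
    expectation ρ (M.disturbance A) = trace ((M.nonselective ρ - ρ).toOp * A) := by
  have h := (TraceClass.summable_trace (ρ.mul_lt_top (heisenbergDual M.nonselective A))).tsum_sub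
    (TraceClass.summable_trace (ρ.mul_lt_top A))
  have e : expectation ρ (M.disturbance A) =
      trace (ρ.toOp * heisenbergDual M.nonselective A) - trace (ρ.toOp * A) := by
    unfold trace
    rw [← h]
    simp [expectation, trace, disturbance, mul_sub]
  rw [e, trace_mul_heisenbergDual]
  exact (map_sub (TraceClass.traceMul A) _ _).symm

lemma norm_expectation_disturbance_le (M : Instrument H ι) (ρ : TraceClass H) (A : H →L[ℂ] H) :
    ‖expectation ρ (M.disturbance A)‖ ≤ M.invasiveness ρ * ‖A‖ := by
  rw [expectation_disturbance, mul_comm]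
  exact TraceClass.norm_trace_mul_le _ _

lemma ratio_le_invasiveness (M : Instrument H ι) (ρ : TraceClass H) (A : H →L[ℂ] H) :
    ‖expectation ρ (M.disturbance A)‖ / ‖A‖ ≤ M.invasiveness ρ :=
  -- For `A = 0` the quotient is `0` by convention, so no case distinction is needed.
  div_le_of_le_mul₀ (norm_nonneg _) (norm_nonneg _) (M.norm_expectation_disturbance_le ρ A)

/-- The invasiveness is approximated by disturbance ratios of self-adjoint compact operators. -/
lemma exists_lt_ratio [Nontrivial H] (M : Instrument H ι) (ρ : TraceClass H) (hρ : 0 ≤ ρ.toOp)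
    {c : ℝ} (hc : c < M.invasiveness ρ) : ∃ A : H →L[ℂ] H, IsSelfAdjoint A ∧
      IsCompactOperator A ∧ A ≠ 0 ∧ c < ‖expectation ρ (M.disturbance A)‖ / ‖A‖ := by
  rcases lt_or_ge c 0 with hc0 | hc0
  -- Ratios are nonnegative, so below a negative `c` any nonzero self-adjoint compact operator will
  -- do; a rank one operator is one.
  · obtain ⟨x, hx⟩ := exists_ne (0 : H)
    refine ⟨InnerProductSpace.rankOne ℂ x x, ?_, isCompactOperator_rankOne x x, ?_,
      hc0.trans_le (by positivity)⟩
    · exact (InnerProductSpace.isPositive_rankOne_self x).isSelfAdjoint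
    · rw [← norm_ne_zero_iff, InnerProductSpace.norm_rankOne]
      simpa using hx
  · have hsa : IsSelfAdjoint (M.nonselective ρ - ρ).toOp :=
      (M.nonselective_nonneg ρ hρ).isSelfAdjoint.sub hρ.isSelfAdjoint
    obtain ⟨A, hA, hAc, hA1, hcA⟩ :=
      (M.nonselective ρ - ρ).exists_isCompactOperator_lt_trace_mul hsa hc
    rw [← expectation_disturbance] at hcA
    -- If `A` were zero its expected disturbance would vanish, whereas it exceeds `c ≥ 0` in norm.
    -- Dividing by `‖A‖ ≤ 1` then only enlarges the value.
    have hA0 : 0 < ‖A‖ := by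
      by_contra h
      have := M.norm_expectation_disturbance_le ρ A
      rw [le_antisymm (not_lt.1 h) (norm_nonneg A), mul_zero] at this
      linarith
    exact ⟨A, hA, hAc, norm_pos_iff.1 hA0, hcA.trans_le
      (le_div_self (norm_nonneg _) hA0 hA1)⟩

/-- The witness is the inclusion of the spectrum into `ℂ`, for which `f(A) = A`; it vanishes at
infinity because the spectrum is compact. -/
lemma ratio_mem_functionRatios (M : Instrument H ι) (ρ : TraceClass H) {A : H →L[ℂ] H}
    (hA : IsSelfAdjoint A) (hA0 : A ≠ 0) :
    ‖expectation ρ (M.disturbance A)‖ / ‖A‖ ∈ M.functionRatios A hA ρ := by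
  have h : cfcHom (R := ℂ) hA.isStarNormal (ZeroAtInftyContinuousMap.ContinuousMap.liftZeroAtInfty
      ((ContinuousMap.id ℂ).restrict (spectrum ℂ A)) : C(spectrum ℂ A, ℂ)) = A :=
    cfcHom_id hA.isStarNormal
  exact ⟨_, by rwa [h], by rw [h]⟩

/-- The constant function `1` gives `f(A) = 1 ≠ 0`, which covers `A = 0` as well, where the identity
function is of no use. An empty set of reals has no least upper bound, so this is needed for the
supremum to be genuine. -/
lemma functionRatios_nonempty [Nontrivial H] (M : Instrument H ι) (ρ : TraceClass H)
    {A : H →L[ℂ] H} (hA : IsSelfAdjoint A) : (M.functionRatios A hA ρ).Nonempty := by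
  have h : cfcHom (R := ℂ) hA.isStarNormal
      (ZeroAtInftyContinuousMap.ContinuousMap.liftZeroAtInfty
        (1 : C(spectrum ℂ A, ℂ)) : C(spectrum ℂ A, ℂ)) = 1 :=
    map_one (cfcHom (R := ℂ) hA.isStarNormal)
  exact ⟨_, _, by rw [h]; exact one_ne_zero, rfl⟩

lemma invasiveness_mem_upperBounds (M : Instrument H ι) (ρ : TraceClass H) {A : H →L[ℂ] H}
    (hA : IsSelfAdjoint A) : M.invasiveness ρ ∈ upperBounds (M.functionRatios A hA ρ) := by
  rintro _ ⟨f, -, rfl⟩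
  exact M.ratio_le_invasiveness ρ _

lemma isLUB_maxDisturbance [Nontrivial H] (M : Instrument H ι) (ρ : TraceClass H)
    {A : H →L[ℂ] H} (hA : IsSelfAdjoint A) :
    IsLUB (M.functionRatios A hA ρ) (M.maxDisturbance A hA ρ) :=
  isLUB_csSup (M.functionRatios_nonempty ρ hA) ⟨_, M.invasiveness_mem_upperBounds ρ hA⟩

end Instrument

/-- On the zero space every trace is `0`, so nothing there has trace `1`. -/
lemma IsState.nontrivial {ρ : TraceClass H} (hρ : IsState ρ) : Nontrivial H := by
  by_contra h
  rw [not_nontrivial_iff_subsingleton] at h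
  have := hρ.2
  rw [Subsingleton.elim ρ.toOp 0] at this
  simp [trace] at this

end

end TraceClassOps

theorem mainTheorem8 {H : Type*} [NormedAddCommGroup H] [InnerProductSpace ℂ H] [CompleteSpace H]
    {ι : Type*} (M : TraceClassOps.Instrument H ι) (ρ : TraceClassOps.TraceClass H)
    (hρ : TraceClassOps.IsState ρ) :
    -- first equality: supremum over nonzero compact operators
    IsLUB {r : ℝ | ∃ A : H →L[ℂ] H, IsCompactOperator A ∧ A ≠ 0 ∧
      r = ‖TraceClassOps.expectation ρ (M.disturbance A)‖ / ‖A‖} (M.invasiveness ρ) ∧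
    -- the supremum that defines each maximum disturbance is a genuine one
    (∀ (A : H →L[ℂ] H) (hA : IsSelfAdjoint A), IsCompactOperator A →
      IsLUB (M.functionRatios A hA ρ) (M.maxDisturbance A hA ρ)) ∧
    -- second equality: supremum over self-adjoint compact operators
    IsLUB {r : ℝ | ∃ (A : H →L[ℂ] H) (hA : IsSelfAdjoint A), IsCompactOperator A ∧
      r = M.maxDisturbance A hA ρ} (M.invasiveness ρ) := by
  have := hρ.nontrivial
  refine ⟨⟨?_, fun b hb => le_of_forall_lt fun c hc => ?_⟩,
    fun A hA _ => M.isLUB_maxDisturbance ρ hA, ⟨?_, fun b hb => le_of_forall_lt fun c hc => ?_⟩⟩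
  · rintro _ ⟨A, -, -, rfl⟩
    exact M.ratio_le_invasiveness ρ A
  · obtain ⟨A, -, hAc, hA0, hcA⟩ := M.exists_lt_ratio ρ hρ.1 hc
    exact hcA.trans_le (hb ⟨A, hAc, hA0, rfl⟩)
  · rintro _ ⟨A, hA, -, rfl⟩
    exact (M.isLUB_maxDisturbance ρ hA).2 (M.invasiveness_mem_upperBounds ρ hA)
  -- The ratio of `A` is one of those defining `Δ_M(A; ρ)`, so it passes from there to any upper
  -- bound `b`.
  · obtain ⟨A, hA, hAc, hA0, hcA⟩ := M.exists_lt_ratio ρ hρ.1 hc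
    exact hcA.trans_le (((M.isLUB_maxDisturbance ρ hA).1
      (M.ratio_mem_functionRatios ρ hA hA0)).trans (hb ⟨A, hA, hAc, rfl⟩))
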